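/- Let \((\Omega,\mathcal A,P)\) be a probability space. For a real random variable \(Y\) on \(\Omega\) let \(F_Y\) be its distribution function and \(q_Y(v)=\inf\{y\in\mathbb R : F_Y(y)\ge v\}\), \(v\in(0,1)\), its quantile function. For bounded random variables \(S,T\), write \(S\le_{cx}T\) if \(\mathbb E\varphi(S)\le\mathbb E\varphi(T)\) for all convex \(\varphi:\mathbb R\to\mathbb R\). For random vectors \((Y,\mathbf X)\) and \((Y',\mathbf X')\) on \(\Omega\) with real-valued \(Y,Y'\) and with \(\mathbf X,\mathbf X'\) of arbitrary (possibly different) dimensions \(p,p'\ge 1\), the conditional convex order \((Y,\mathbf X)\preccurlyeq_{ccx}(Y',\mathbf X')\) means \[P(Y\ge q_Y(v)\mid\mathbf X)\le_{cx}P(Y'\ge q_{Y'}(v)\mid\mathbf X')\quad\text{for all }v\in(0,1),\] and \(=_{ccx}\) means that \(\preccurlyeq_{ccx}\) holds in both directions. \(Y\) is called perfectly dependent on \(\mathbf X\) if \(Y=f(\mathbf X)\) almost surely for some measurable function \(f\). Theorem. Let \(A\subseteq[0,1]\) be closed and let \(\mathcal R_A\) be the class of all random vectors \((Y,\mathbf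 X):\Omega\to\mathbb R^{1+p}\), \(p\ge 1\) arbitrary, such that the closure of the range of \(F_Y\) equals \(A\). Then \(\preccurlyeq_{ccx}\) satisfies the following on \(\mathcal R_A\); here \((Y,\mathbf X)\) and \((Y',\mathbf X')\) denote elements of \(\mathcal R_A\), and \(\mathbf Z\) is any random vector on \(\Omega\). (O1) Law-invariance: if \((Y,\mathbf X)\) and \((Y',\mathbf X')\) have the same distribution, then \((Y,\mathbf X)=_{ccx}(Y',\mathbf X')\). (O2) \(\preccurlyeq_{ccx}\) is reflexive and transitive on \(\mathcal R_A\). (O3) \((Y,\mathbf X)\preccurlyeq_{ccx}(Y',\mathbf X')\) for all \((Y',\mathbf X')\in\mathcal R_A\) if and only if \(\mathbf X\) and \(Y\) are independent. (O4) \((Y',\mathbf X')\preccurlyeq_{ccx}(Y,\mathbf X)\) for all \((Y',\mathbf X')\in\mathcal R_A\) if and only if \(Y\) is perfectly dependent on \(\mathbf X\). (O5) Information monotonicity: \((Y,\mathbf X)\preccurlyeq_{ccx}(Y,(\mathbf X,\mathbf Z))\). (O6) \((Y,\mathbf X)=_{ccx}(Y,(\mathbf X,\mathbf Z))\) if and only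 if \(Y\) and \(\mathbf Z\) are conditionally independent given \(\mathbf X\). (O7) Transformation invariance: for every strictly increasing \(g:\mathbb R\to\mathbb R\) and every measurable bijection \(\mathbf h:\mathbb R^p\to\mathbb R^q\) (where \(p\) is the dimension of \(\mathbf X\)), \((g(Y),\mathbf h(\mathbf X))\in\mathcal R_A\) and \((Y,\mathbf X)=_{ccx}(g(Y),\mathbf h(\mathbf X))\). (O8) Distributional invariance: \((F_Y(Y),\mathbf X)\in\mathcal R_A\) and \((Y,\mathbf F_{\mathbf X}(\mathbf X))\in\mathcal R_A\), with \((Y,\mathbf X)=_{ccx}(F_Y(Y),\mathbf X)\) and \((Y,\mathbf X)=_{ccx}(Y,\mathbf F_{\mathbf X}(\mathbf X))\), where \(\mathbf F_{\mathbf X}(\mathbf X)=(F_{X_1}(X_1),\dots,F_{X_p}(X_p))\). -/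

import Mathlib

open MeasureTheory ProbabilityTheory Set

noncomputable section

namespace CCX

variable {Ω : Type*} [MeasurableSpace Ω]

/-- The distribution function `F_Y` of a real random variable `Y` under `μ`. -/
def distFun (μ : Measure Ω) (Y : Ω → ℝ) : ℝ → ℝ := fun y => cdf (μ.map Y) y

/-- The left-continuous quantile function `q_Y(v) = inf {y | F_Y(y) ≥ v}` (used for `0 < v < 1`,
where the set is nonempty and bounded below). -/
def quantile (μ : Measure Ω) (Y : Ω → ℝ) (v : ℝ) : ℝ := sInf {y : ℝ | v ≤ distFun μ Y y}

/-- The convex order `S ≤_cx T` of (essentially bounded) random variables: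
`E φ(S) ≤ E φ(T)` for all convex `φ : ℝ → ℝ`.  For essentially bounded `S`, `T` both expectations
are automatically finite, since a convex function on `ℝ` is continuous. -/
def ConvexOrder (μ : Measure Ω) (S T : Ω → ℝ) : Prop :=
  ∀ φ : ℝ → ℝ, ConvexOn ℝ univ φ → ∫ ω, φ (S ω) ∂μ ≤ ∫ ω, φ (T ω) ∂μ

/-- The conditional survival probability `P(Y ≥ y | X)`, a version of the conditional expectation of
the indicator of `{Y ≥ y}` given the σ-algebra generated by `X`. -/
def condSurv (μ : Measure Ω) (Y : Ω → ℝ) {p : ℕ} (X : Ω → Fin p → ℝ) (y : ℝ) : Ω → ℝ :=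
  μ⟦{ω | y ≤ Y ω} | MeasurableSpace.comap X inferInstance⟧

/-- The conditional convex order `(Y, X) ≼_ccx (Y', X')`. -/
def Le (μ : Measure Ω) (Y : Ω → ℝ) {p : ℕ} (X : Ω → Fin p → ℝ)
    (Y' : Ω → ℝ) {p' : ℕ} (X' : Ω → Fin p' → ℝ) : Prop :=
  ∀ v ∈ Ioo (0 : ℝ) 1,
    ConvexOrder μ (condSurv μ Y X (quantile μ Y v)) (condSurv μ Y' X' (quantile μ Y' v))

/-- `(Y, X) =_ccx (Y', X')`: the order holds in both directions. -/
def Equiv (μ : Measure Ω) (Y : Ω → ℝ) {p : ℕ} (X : Ω → Fin p → ℝ)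
    (Y' : Ω → ℝ) {p' : ℕ} (X' : Ω → Fin p' → ℝ) : Prop :=
  Le μ Y X Y' X' ∧ Le μ Y' X' Y X

/-- Membership of `(Y, X)` in the class `R_A`: `(Y, X)` is a random vector on `Ω` with values in
`ℝ^(1+p)`, `p ≥ 1`, and the closure of the range of `F_Y` is `A`. -/
structure MemClass (μ : Measure Ω) (A : Set ℝ) (Y : Ω → ℝ) {p : ℕ} (X : Ω → Fin p → ℝ) :
    Prop where
  one_le_dim : 1 ≤ p
  measurable_fst : Measurable Y
  measurable_snd : Measurable X
  closure_range : closure (range (distFun μ Y)) = A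

/-- `Y` is perfectly dependent on `X`: `Y = f(X)` almost surely for some measurable `f`. -/
def PerfectlyDependent (μ : Measure Ω) (Y : Ω → ℝ) {p : ℕ} (X : Ω → Fin p → ℝ) : Prop :=
  ∃ f : (Fin p → ℝ) → ℝ, Measurable f ∧ Y =ᵐ[μ] fun ω => f (X ω)

/-- `Y` and `Z` are conditionally independent given `X`: for all Borel sets `s`, `t`,
`P(Y ∈ s, Z ∈ t | X) = P(Y ∈ s | X) P(Z ∈ t | X)` almost surely.  (Mathlib's `CondIndepFun` is this
notion, but is available on standard Borel spaces `Ω` only.) -/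
def CondIndepGiven (μ : Measure Ω) (Y : Ω → ℝ) {q : ℕ} (Z : Ω → Fin q → ℝ)
    {p : ℕ} (X : Ω → Fin p → ℝ) : Prop :=
  ∀ (s : Set ℝ) (t : Set (Fin q → ℝ)), MeasurableSet s → MeasurableSet t →
    μ⟦Y ⁻¹' s ∩ Z ⁻¹' t | MeasurableSpace.comap X inferInstance⟧ =ᵐ[μ]
      μ⟦Y ⁻¹' s | MeasurableSpace.comap X inferInstance⟧ *
        μ⟦Z ⁻¹' t | MeasurableSpace.comap X inferInstance⟧

/-- The joint random vector `(X, Z)` with values in `ℝ^(p+q)`. -/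
def join {p q : ℕ} (X : Ω → Fin p → ℝ) (Z : Ω → Fin q → ℝ) : Ω → Fin (p + q) → ℝ :=
  fun ω => Fin.append (X ω) (Z ω)

/-- The random vector `(F_{X_1}(X_1), …, F_{X_p}(X_p))`. -/
def marginalTransform (μ : Measure Ω) {p : ℕ} (X : Ω → Fin p → ℝ) : Ω → Fin p → ℝ :=
  fun ω i => distFun μ (fun ω' => X ω' i) (X ω i)

end CCX

end

/-! At a fixed level `v` the order compares conditional probabilities of the events `{Y ≥ q_Y(v)}`,
and the class `R_A` is built so that these events have equal probability for all its members: `P(Y <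
q_Y(v))` is the supremum of `A ∩ (-∞, v)` (`isLUB_closure_range_distFun`). All conditional
probabilities compared are thus `[0, 1]`-valued with a common mean. In convex order the least such
variable is the constant, attained under independence, and the greatest is an indicator, attained
under perfect dependence. Enlarging the σ-algebra moves upward, by conditional Jensen.

The converses rest on rigidity. For nested σ-algebras the test function `x ^ 2` suffices: equal
second moments force the two conditional probabilities to agree, by Pythagoras in `L²`. Agreement at
the quantiles of `Y` then extends to all Borel events (`condProb_preimage_ae_eq_of_quantile`).
Comparing `X` with a constant vector yields independence, comparing it with `(X, Y)` yields perfect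
dependence, and comparing it with `(X, Z)` yields conditional independence.

For the invariances, a monotone `g` with `P(g(Y) ≤ g(y)) = P(Y ≤ y)` preserves `A`, and both
quantile events are preimages under `Y` of upper sets. They are nested with equal probability, hence
almost surely equal. Strictly increasing maps and `F_Y` are both of this kind. -/

namespace CCX

/-! ### Conditional probabilities: convex order, rigidity, extension to Borel events -/

section CondProb

variable {Ω : Type*} {m m₁ m₂ m₀ : MeasurableSpace Ω} {μ : Measure Ω}

theorem ConvexOrder.of_ae_eq {S T : Ω → ℝ} (h : S =ᵐ[μ] T) : ConvexOrder μ S T := fun φ _ =>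
  (integral_congr_ae (h.mono fun ω hω => by simp [hω])).le

theorem condProb_congr_set {s t : Set Ω} (h : s =ᵐ[μ] t) : μ⟦s | m⟧ =ᵐ[μ] μ⟦t | m⟧ :=
  condExp_congr_ae (indicator_ae_eq_of_ae_eq_set h)

variable [IsProbabilityMeasure μ]

theorem integrable_indicator_const_one {s : Set Ω} (hs : MeasurableSet s) :
    Integrable (s.indicator fun _ => (1 : ℝ)) μ :=
  (integrable_const 1).indicator hs

theorem condProb_mem_Icc (hm : m ≤ m₀) {s : Set Ω} (hs : MeasurableSet s) :
    ∀ᵐ ω ∂μ, (μ⟦s | m⟧) ω ∈ Icc (0 : ℝ) 1 := by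
  refine (convex_Icc (0 : ℝ) 1).condExp_mem hm (integrable_indicator_const_one hs) isClosed_Icc ?_
  refine .of_forall fun ω => ?_
  by_cases h : ω ∈ s <;> simp [h]

theorem integral_condProb (hm : m ≤ m₀) {s : Set Ω} (hs : MeasurableSet s) :
    ∫ ω, (μ⟦s | m⟧) ω ∂μ = μ.real s := by
  rw [integral_condExp hm, integral_indicator_const _ hs]
  simp

theorem _root_.ConvexOn.continuous_real {φ : ℝ → ℝ} (hφ : ConvexOn ℝ univ φ) : Continuous φ :=
  continuousOn_univ.1 (hφ.continuousOn isOpen_univ)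

theorem integrable_comp_of_mem_Icc {φ : ℝ → ℝ} (hφ : Continuous φ) {S : Ω → ℝ}
    (hS : AEStronglyMeasurable S μ) {a b : ℝ} (h : ∀ᵐ ω ∂μ, S ω ∈ Icc a b) :
    Integrable (fun ω => φ (S ω)) μ := by
  obtain ⟨C, hC⟩ := isCompact_Icc.exists_bound_of_continuousOn (hφ.continuousOn (s := Icc a b))
  refine Integrable.of_bound (hφ.comp_aestronglyMeasurable hS) C ?_
  filter_upwards [h] with ω hω using hC _ hω

theorem integrable_comp_condProb (hm : m ≤ m₀) {φ : ℝ → ℝ} (hφ : Continuous φ) {s : Set Ω}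
    (hs : MeasurableSet s) : Integrable (fun ω => φ ((μ⟦s | m⟧) ω)) μ :=
  integrable_comp_of_mem_Icc hφ integrable_condExp.aestronglyMeasurable (condProb_mem_Icc hm hs)

/-- A finer σ-algebra makes a conditional probability larger in convex order. -/
theorem convexOrder_condProb (h₁₂ : m₁ ≤ m₂) (hm₂ : m₂ ≤ m₀) {s : Set Ω} (hs : MeasurableSet s) :
    ConvexOrder μ (μ⟦s | m₁⟧) (μ⟦s | m₂⟧) := by
  intro φ hφ
  have hc := hφ.continuous_real
  have hi := integrable_comp_condProb (μ := μ) hm₂ hc hs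
  have hJ := hφ.map_condExp_le (μ := μ) (h₁₂.trans hm₂) (hc.lowerSemicontinuous.lowerSemicontinuousOn _)
    (f := μ⟦s | m₂⟧) (.of_forall fun _ => mem_univ _) isClosed_univ integrable_condExp hi
  have ht := condExp_condExp_of_le (f := s.indicator fun _ => (1 : ℝ)) (μ := μ) h₁₂ hm₂
  calc ∫ ω, φ ((μ⟦s | m₁⟧) ω) ∂μ ≤ ∫ ω, (μ[φ ∘ (μ⟦s | m₂⟧) | m₁]) ω ∂μ := by
        refine integral_mono_ae (integrable_comp_condProb (h₁₂.trans hm₂) hc hs)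
          integrable_condExp ?_
        filter_upwards [hJ, ht] with ω h1 h2
        simpa [h2] using h1
    _ = _ := integral_condExp (h₁₂.trans hm₂)

/-- Every `[0, 1]`-valued random variable is dominated in convex order by an indicator function
with the same mean. -/
theorem convexOrder_indicator {S T : Ω → ℝ} (hS : AEStronglyMeasurable S μ)
    (hS01 : ∀ᵐ ω ∂μ, S ω ∈ Icc (0 : ℝ) 1) {t : Set Ω} (ht : MeasurableSet t)
    (hT : T =ᵐ[μ] t.indicator fun _ => (1 : ℝ)) (hmean : ∫ ω, S ω ∂μ = μ.real t) :
    ConvexOrder μ S T := by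
  intro φ hφ
  have hSi : Integrable S μ := integrable_comp_of_mem_Icc continuous_id hS hS01
  have hR : ∫ ω, φ (T ω) ∂μ = φ 0 + (φ 1 - φ 0) * μ.real t := by
    have : ∫ ω, φ (T ω) ∂μ =
        ∫ ω, (φ 0 + (φ 1 - φ 0) * t.indicator (fun _ => (1 : ℝ)) ω) ∂μ := by
      refine integral_congr_ae ?_
      filter_upwards [hT] with ω hω
      by_cases h : ω ∈ t <;> simp [hω, h]
    rw [this, integral_add (integrable_const _)
      ((integrable_indicator_const_one ht).const_mul _), integral_const_mul,
      integral_indicator_const _ ht]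
    simp
  have hL : ∫ ω, φ (S ω) ∂μ ≤ ∫ ω, (φ 0 + (φ 1 - φ 0) * S ω) ∂μ := by
    refine integral_mono_ae (integrable_comp_of_mem_Icc hφ.continuous_real hS hS01)
      ((integrable_const _).add (hSi.const_mul _)) ?_
    filter_upwards [hS01] with ω hω
    -- On `[0, 1]` a convex function lies below its chord, and an indicator takes values only at the
    -- endpoints, where the two agree.
    have := hφ.2 (mem_univ 0) (mem_univ 1) (sub_nonneg.2 hω.2) hω.1 (by ring)
    simp only [smul_eq_mul, mul_zero, mul_one, zero_add] at this
    linarith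
  rw [hR]
  rwa [integral_add (integrable_const _) (hSi.const_mul _), integral_const_mul, hmean,
    integral_const, probReal_univ, one_smul] at hL

/-- Pythagoras: with `S`, `T` the coarse and fine versions, `S` is the projection of `T`, so `E[ST]
= E[S²]` and `E[(T - S)²] = E[T²] - E[S²] ≤ 0`. -/
theorem condProb_ae_eq_of_integral_sq_le (h₁₂ : m₁ ≤ m₂) (hm₂ : m₂ ≤ m₀) {s : Set Ω}
    (hs : MeasurableSet s)
    (h : ∫ ω, (μ⟦s | m₂⟧) ω ^ 2 ∂μ ≤ ∫ ω, (μ⟦s | m₁⟧) ω ^ 2 ∂μ) :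
    μ⟦s | m₂⟧ =ᵐ[μ] μ⟦s | m₁⟧ := by
  set S := μ⟦s | m₁⟧ with hS
  set T := μ⟦s | m₂⟧ with hT
  have hm₁ := h₁₂.trans hm₂
  have hS2 : Integrable (fun ω => S ω ^ 2) μ :=
    integrable_comp_condProb hm₁ (φ := fun x => x ^ 2) (by fun_prop) hs
  have hT2 : Integrable (fun ω => T ω ^ 2) μ :=
    integrable_comp_condProb hm₂ (φ := fun x => x ^ 2) (by fun_prop) hs
  have hST : Integrable (S * T) μ := by
    refine Integrable.of_bound (integrable_condExp.aestronglyMeasurable.mul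
      integrable_condExp.aestronglyMeasurable) 1 ?_
    filter_upwards [condProb_mem_Icc (μ := μ) hm₁ hs, condProb_mem_Icc (μ := μ) hm₂ hs]
      with ω h1 h2
    simp only [Pi.mul_apply, norm_mul, Real.norm_eq_abs]
    exact mul_le_one₀ (abs_le.2 ⟨by linarith [h1.1], h1.2⟩) (abs_nonneg _)
      (abs_le.2 ⟨by linarith [h2.1], h2.2⟩)
  have hcross : ∫ ω, S ω * T ω ∂μ = ∫ ω, S ω ^ 2 ∂μ := by
    rw [← integral_condExp hm₁ (f := fun ω => S ω * T ω)]
    refine integral_congr_ae ?_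
    filter_upwards [condExp_mul_of_stronglyMeasurable_left (μ := μ) (m := m₁) (f := S) (g := T)
      stronglyMeasurable_condExp hST integrable_condExp,
      condExp_condExp_of_le (f := s.indicator fun _ => (1 : ℝ)) (μ := μ) h₁₂ hm₂] with ω h1 h2
    have h1' : (μ[fun ω => S ω * T ω | m₁]) ω = S ω * (μ[T | m₁]) ω := h1
    rw [h1', h2, sq]
  have hint : ∫ ω, (T ω - S ω) ^ 2 ∂μ = ∫ ω, T ω ^ 2 ∂μ - ∫ ω, S ω ^ 2 ∂μ := by
    have : ∀ ω, (T ω - S ω) ^ 2 = (T ω ^ 2 + S ω ^ 2) - 2 * (S ω * T ω) := fun ω => by ring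
    simp_rw [this]
    have hST' : Integrable (fun ω => 2 * (S ω * T ω)) μ := hST.const_mul 2
    rw [integral_sub (f := fun ω => T ω ^ 2 + S ω ^ 2) (hT2.add hS2) hST', integral_add hT2 hS2,
      integral_const_mul, hcross]
    ring
  have hint' : Integrable (fun ω => (T ω - S ω) ^ 2) μ := by
    have : (fun ω => (T ω - S ω) ^ 2) = fun ω => (T ω ^ 2 + S ω ^ 2) - 2 * (S ω * T ω) := by
      ext ω; ring
    rw [this]
    exact (hT2.add hS2).sub (hST.const_mul 2)
  have h0 : ∫ ω, (T ω - S ω) ^ 2 ∂μ = 0 :=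
    le_antisymm (by linarith) (integral_nonneg fun ω => sq_nonneg _)
  filter_upwards [(integral_eq_zero_iff_of_nonneg (fun ω => sq_nonneg _) hint').1 h0] with ω hω
  have := pow_eq_zero_iff two_ne_zero |>.1 hω
  linarith

theorem condProb_ae_eq_of_convexOrder (h₁₂ : m₁ ≤ m₂) (hm₂ : m₂ ≤ m₀) {s : Set Ω}
    (hs : MeasurableSet s) (h : ConvexOrder μ (μ⟦s | m₂⟧) (μ⟦s | m₁⟧)) :
    μ⟦s | m₂⟧ =ᵐ[μ] μ⟦s | m₁⟧ :=
  condProb_ae_eq_of_integral_sq_le h₁₂ hm₂ hs (h (fun x => x ^ 2) even_two.convexOn_pow)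

theorem condProb_compl (hm : m ≤ m₀) {s : Set Ω} (hs : MeasurableSet s) :
    μ⟦sᶜ | m⟧ =ᵐ[μ] 1 - μ⟦s | m⟧ := by
  have : sᶜ.indicator (fun _ => (1 : ℝ)) = (fun _ => (1 : ℝ)) - s.indicator fun _ => (1 : ℝ) := by
    ext ω
    by_cases h : ω ∈ s <;> simp [h]
  rw [this]
  refine (condExp_sub (integrable_const 1) (integrable_indicator_const_one hs) m).trans ?_
  rw [condExp_const hm]
  rfl

theorem condProb_union {s t : Set Ω} (hs : MeasurableSet s) (ht : MeasurableSet t)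
    (hd : Disjoint s t) : μ⟦s ∪ t | m⟧ =ᵐ[μ] μ⟦s | m⟧ + μ⟦t | m⟧ := by
  rw [indicator_union_of_disjoint hd]
  exact condExp_add (integrable_indicator_const_one hs) (integrable_indicator_const_one ht) m

/-- Conditional expectation is an `L¹` contraction, so the bound is uniform in the σ-algebra. -/
theorem integral_abs_condProb_sub_le {s t : Set Ω} (hs : MeasurableSet s) (ht : MeasurableSet t)
    (hts : t ⊆ s) : ∫ ω, |(μ⟦s | m⟧) ω - (μ⟦t | m⟧) ω| ∂μ ≤ μ.real (s \ t) := by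
  have h1 : μ⟦s \ t | m⟧ =ᵐ[μ] μ⟦s | m⟧ - μ⟦t | m⟧ := by
    have h := condProb_union (μ := μ) (m := m) ht (hs.diff ht) disjoint_sdiff_self_right
    rw [union_sdiff_cancel hts] at h
    filter_upwards [h] with ω hω
    simp [hω]
  calc ∫ ω, |(μ⟦s | m⟧) ω - (μ⟦t | m⟧) ω| ∂μ = ∫ ω, |(μ⟦s \ t | m⟧) ω| ∂μ :=
        integral_congr_ae (h1.mono fun ω hω => by simp [hω])
    _ ≤ ∫ ω, |(s \ t).indicator (fun _ => (1 : ℝ)) ω| ∂μ := integral_abs_condExp_le _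
    _ = μ.real (s \ t) := by
        rw [← mul_one (μ.real (s \ t)), ← smul_eq_mul, ← integral_indicator_const _ (hs.diff ht)]
        refine integral_congr_ae (.of_forall fun ω => ?_)
        exact abs_of_nonneg (indicator_nonneg (fun _ _ => zero_le_one) ω)

/-- Equality of conditional probabilities is preserved under approximation from within. -/
theorem condProb_ae_eq_of_approx {s : Set Ω} (hs : MeasurableSet s)
    (h : ∀ ε > 0, ∃ t ⊆ s, MeasurableSet t ∧ μ.real (s \ t) ≤ ε ∧ μ⟦t | m₂⟧ =ᵐ[μ] μ⟦t | m₁⟧) :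
    μ⟦s | m₂⟧ =ᵐ[μ] μ⟦s | m₁⟧ := by
  have hint : Integrable (fun ω => (μ⟦s | m₂⟧) ω - (μ⟦s | m₁⟧) ω) μ :=
    integrable_condExp.sub integrable_condExp
  have h0 : ∫ ω, |(μ⟦s | m₂⟧) ω - (μ⟦s | m₁⟧) ω| ∂μ = 0 := by
    refine le_antisymm (le_of_forall_pos_le_add fun ε hε => ?_)
      (integral_nonneg fun ω => abs_nonneg _)
    obtain ⟨t, hts, ht, hle, heq⟩ := h (ε / 2) (half_pos hε)
    have hi (m' : MeasurableSpace Ω) :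
        Integrable (fun ω => |(μ⟦s | m'⟧) ω - (μ⟦t | m'⟧) ω|) μ :=
      (integrable_condExp.sub integrable_condExp).abs
    calc ∫ ω, |(μ⟦s | m₂⟧) ω - (μ⟦s | m₁⟧) ω| ∂μ
        ≤ ∫ ω, (|(μ⟦s | m₂⟧) ω - (μ⟦t | m₂⟧) ω| + |(μ⟦s | m₁⟧) ω - (μ⟦t | m₁⟧) ω|) ∂μ := by
          refine integral_mono_ae hint.abs ((hi m₂).add (hi m₁)) ?_
          filter_upwards [heq] with ω hω
          rw [hω, abs_sub_comm ((μ⟦s | m₁⟧) ω)]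
          exact abs_sub_le _ _ _
      _ = _ := integral_add (hi m₂) (hi m₁)
      _ ≤ ε / 2 + ε / 2 := add_le_add ((integral_abs_condProb_sub_le hs ht hts).trans hle)
          ((integral_abs_condProb_sub_le hs ht hts).trans hle)
      _ = 0 + ε := by ring
  filter_upwards [(integral_eq_zero_iff_of_nonneg (fun ω => abs_nonneg _) hint.abs).1 h0] with ω hω
  exact sub_eq_zero.1 (abs_eq_zero.1 hω)

theorem condProb_iUnion_ae_eq (f : ℕ → Set Ω) (hf : ∀ i, MeasurableSet (f i))
    (hd : Pairwise (Function.onFun Disjoint f))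
    (h : ∀ i, μ⟦f i | m₂⟧ =ᵐ[μ] μ⟦f i | m₁⟧) :
    μ⟦⋃ i, f i | m₂⟧ =ᵐ[μ] μ⟦⋃ i, f i | m₁⟧ := by
  have hacm (n : ℕ) : MeasurableSet (accumulate f n) :=
    .biUnion (to_countable _) fun i _ => hf i
  have hacc (n : ℕ) : μ⟦accumulate f n | m₂⟧ =ᵐ[μ] μ⟦accumulate f n | m₁⟧ := by
    induction n with
    | zero => simpa using h 0
    | succ n ih =>
      have hdj : Disjoint (accumulate f n) (f (n + 1)) := disjoint_accumulate hd n.lt_succ_self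
      rw [accumulate_succ]
      filter_upwards [ih, h (n + 1), condProb_union (m := m₁) (μ := μ) (hacm n) (hf _) hdj,
        condProb_union (m := m₂) (μ := μ) (hacm n) (hf _) hdj] with ω h1 h2 h3 h4
      rw [h3, h4, Pi.add_apply, Pi.add_apply, h1, h2]
  refine condProb_ae_eq_of_approx (.iUnion hf) fun ε hε => ?_
  have ht : Filter.Tendsto (fun n => μ.real (accumulate f n)) Filter.atTop
      (nhds (μ.real (⋃ i, f i))) := by
    have := tendsto_measure_iUnion_accumulate (μ := μ) (f := f)
    exact (ENNReal.tendsto_toReal (measure_ne_top _ _)).comp this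
  obtain ⟨n, hn⟩ := (ht.eventually (lt_mem_nhds (sub_lt_self _ hε))).exists
  refine ⟨accumulate f n, accumulate_subset_iUnion n, hacm n, ?_, hacc n⟩
  rw [measureReal_sdiff (accumulate_subset_iUnion n) (hacm n)]
  linarith

/-- Equality of the conditional laws of `Y` may be checked on upper half-lines. -/
theorem condProb_preimage_ae_eq_of_Ici (hm₁ : m₁ ≤ m₀) (hm₂ : m₂ ≤ m₀) {Y : Ω → ℝ}
    (hY : Measurable Y) (h : ∀ y, μ⟦{ω | y ≤ Y ω} | m₂⟧ =ᵐ[μ] μ⟦{ω | y ≤ Y ω} | m₁⟧)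
    {s : Set ℝ} (hs : MeasurableSet s) : μ⟦Y ⁻¹' s | m₂⟧ =ᵐ[μ] μ⟦Y ⁻¹' s | m₁⟧ := by
  induction s, hs using MeasurableSpace.induction_on_inter
    (BorelSpace.measurable_eq.trans (borel_eq_generateFrom_Ici ℝ)) isPiSystem_Ici with
  | empty => simp
  | basic t ht =>
    obtain ⟨y, rfl⟩ := ht
    exact h y
  | compl t ht ih =>
    filter_upwards [ih, condProb_compl (μ := μ) hm₁ (hY ht),
      condProb_compl (μ := μ) hm₂ (hY ht)] with ω h1 h2 h3
    rw [preimage_compl, h2, h3, Pi.sub_apply, Pi.sub_apply, h1]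
  | iUnion f hd hf ih =>
    rw [preimage_iUnion]
    exact condProb_iUnion_ae_eq _ (fun i => hY (hf i))
      (fun i j hij => (hd hij).preimage Y) ih

end CondProb

/-! ### Distribution functions, quantiles and monotone transformations -/

section Quantile

variable {Ω : Type*} {m₁ m₂ m₀ : MeasurableSpace Ω} {μ : Measure Ω}
  {Y : Ω → ℝ}

theorem monotone_distFun (μ : Measure Ω) (Y : Ω → ℝ) : Monotone (distFun μ Y) :=
  monotone_cdf _

/-- Right-continuity of the distribution function makes the infimum defining the quantile attained.
-/
theorem le_distFun_iff {v : ℝ} (hv : v ∈ Ioo (0 : ℝ) 1) (y : ℝ) :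
    v ≤ distFun μ Y y ↔ quantile μ Y v ≤ y := by
  have hne : {y : ℝ | v ≤ distFun μ Y y}.Nonempty :=
    ((tendsto_cdf_atTop (μ.map Y)).eventually (le_mem_nhds hv.2)).exists
  have hbdd : BddBelow {y : ℝ | v ≤ distFun μ Y y} := by
    obtain ⟨b, hb⟩ := ((tendsto_cdf_atBot (μ.map Y)).eventually (gt_mem_nhds hv.1)).exists
    refine ⟨b, fun z hz => le_of_lt ?_⟩
    by_contra! h
    exact absurd (hz.trans (monotone_distFun μ Y h)) (not_le.2 hb)
  refine ⟨fun h => csInf_le hbdd h, fun h => ?_⟩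
  have hright : ∀ z > y, v ≤ distFun μ Y z := fun z hz => by
    obtain ⟨a, ha, haz⟩ := exists_lt_of_csInf_lt hne (h.trans_lt hz)
    exact le_trans ha (monotone_distFun μ Y haz.le)
  have hc : Filter.Tendsto (distFun μ Y) (nhdsWithin y (Ioi y)) (nhds (distFun μ Y y)) :=
    ((cdf (μ.map Y)).right_continuous y).mono Ioi_subset_Ici_self
  exact ge_of_tendsto hc (Filter.eventually_of_mem self_mem_nhdsWithin hright)

theorem distFun_lt_iff {v : ℝ} (hv : v ∈ Ioo (0 : ℝ) 1) (y : ℝ) :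
    distFun μ Y y < v ↔ y < quantile μ Y v := by
  rw [← not_le, le_distFun_iff hv, not_le]

theorem range_distFun_inter_Iio {v : ℝ} (hv : v ∈ Ioo (0 : ℝ) 1) :
    range (distFun μ Y) ∩ Iio v = distFun μ Y '' Iio (quantile μ Y v) := by
  ext x
  constructor
  · rintro ⟨⟨y, rfl⟩, hy⟩
    exact ⟨y, (distFun_lt_iff hv y).1 hy, rfl⟩
  · rintro ⟨y, hy, rfl⟩
    exact ⟨⟨y, rfl⟩, (distFun_lt_iff hv y).2 hy⟩

variable [IsProbabilityMeasure μ]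

theorem distFun_eq (hY : Measurable Y) (y : ℝ) : distFun μ Y y = μ.real {ω | Y ω ≤ y} := by
  have := Measure.isProbabilityMeasure_map (μ := μ) hY.aemeasurable
  rw [distFun, cdf_eq_real, map_measureReal_apply hY measurableSet_Iic]
  rfl

theorem isLUB_distFun_image_Iio (hY : Measurable Y) (a : ℝ) :
    IsLUB (distFun μ Y '' Iio a) (μ.real {ω | Y ω < a}) := by
  obtain ⟨u, hu, hua, hlim⟩ := exists_seq_strictMono_tendsto a
  have hU : {ω | Y ω < a} = ⋃ n, {ω | Y ω ≤ u n} := by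
    ext ω
    simp only [mem_ofPred_eq, mem_iUnion]
    refine ⟨fun h => ?_, fun ⟨n, hn⟩ => hn.trans_lt (hua n)⟩
    obtain ⟨n, hn⟩ := (hlim.eventually (lt_mem_nhds h)).exists
    exact ⟨n, hn.le⟩
  have ht : Filter.Tendsto (fun n => distFun μ Y (u n)) Filter.atTop
      (nhds (μ.real {ω | Y ω < a})) := by
    simp_rw [distFun_eq hY, hU]
    refine (ENNReal.tendsto_toReal (measure_ne_top _ _)).comp (tendsto_measure_iUnion_atTop ?_)
    exact fun i j hij ω (hω : Y ω ≤ u i) => hω.trans (hu.monotone hij)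
  refine ⟨?_, fun b hb => ?_⟩
  · rintro _ ⟨y, hy, rfl⟩
    rw [distFun_eq hY]
    exact measureReal_mono fun ω (hω : Y ω ≤ y) => lt_of_le_of_lt hω hy
  · exact le_of_tendsto' ht fun n => hb ⟨u n, hua n, rfl⟩

/-- The values of `F_Y` below `v` are those taken left of the quantile, with supremum `P(Y <
q_Y(v))`. Since `Iio v` is open, closing the range adds only limits of such values. Hence this
probability depends on `Y` only through the closed range. -/
theorem isLUB_closure_range_distFun (hY : Measurable Y) {v : ℝ} (hv : v ∈ Ioo (0 : ℝ) 1) :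
    IsLUB (closure (range (distFun μ Y)) ∩ Iio v) (μ.real {ω | Y ω < quantile μ Y v}) := by
  have h := isLUB_distFun_image_Iio (μ := μ) hY (quantile μ Y v)
  rw [← range_distFun_inter_Iio hv] at h
  refine ⟨fun x hx => ?_, fun b hb => h.2 fun x hx => hb ⟨subset_closure hx.1, hx.2⟩⟩
  have hx' : x ∈ closure (range (distFun μ Y) ∩ Iio v) :=
    inter_comm (Iio v) _ ▸ isOpen_Iio.inter_closure ⟨hx.2, hx.1⟩
  have h1 := h.1
  rw [← upperBounds_closure] at h1
  exact h1 hx'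

theorem measureReal_lt_quantile_le (hY : Measurable Y) {v : ℝ} (hv : v ∈ Ioo (0 : ℝ) 1) :
    μ.real {ω | Y ω < quantile μ Y v} ≤ v :=
  (isLUB_closure_range_distFun hY hv).2 fun _ hx => hx.2.le

theorem measureReal_le_eq_one_sub (hY : Measurable Y) (a : ℝ) :
    μ.real {ω | a ≤ Y ω} = 1 - μ.real {ω | Y ω < a} := by
  rw [← probReal_compl_eq_one_sub (measurableSet_lt hY measurable_const)]
  congr 1
  ext ω
  simp

theorem measureReal_quantile_le_eq {Y' : Ω → ℝ} (hY : Measurable Y) (hY' : Measurable Y')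
    (h : closure (range (distFun μ Y)) = closure (range (distFun μ Y'))) {v : ℝ}
    (hv : v ∈ Ioo (0 : ℝ) 1) :
    μ.real {ω | quantile μ Y v ≤ Y ω} = μ.real {ω | quantile μ Y' v ≤ Y' ω} := by
  have h1 := isLUB_closure_range_distFun (μ := μ) hY hv
  rw [h] at h1
  rw [measureReal_le_eq_one_sub hY, measureReal_le_eq_one_sub hY',
    h1.unique (isLUB_closure_range_distFun hY' hv)]

/-- The conditional law of `Y` is determined by the conditional probabilities of exceeding the
quantiles of `Y`. -/
theorem condProb_preimage_ae_eq_of_quantile (hm₁ : m₁ ≤ m₀) (hm₂ : m₂ ≤ m₀) (hY : Measurable Y)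
    (h : ∀ v ∈ Ioo (0 : ℝ) 1, μ⟦{ω | quantile μ Y v ≤ Y ω} | m₂⟧
      =ᵐ[μ] μ⟦{ω | quantile μ Y v ≤ Y ω} | m₁⟧)
    {s : Set ℝ} (hs : MeasurableSet s) : μ⟦Y ⁻¹' s | m₂⟧ =ᵐ[μ] μ⟦Y ⁻¹' s | m₁⟧ := by
  refine condProb_preimage_ae_eq_of_Ici hm₁ hm₂ hY (fun y => ?_) hs
  have hmeas (a : ℝ) : MeasurableSet {ω | a ≤ Y ω} := measurableSet_le measurable_const hY
  refine condProb_ae_eq_of_approx (hmeas y) fun ε hε => ?_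
  set w := μ.real {ω | Y ω < y} with hw
  have hw0 : 0 ≤ w := measureReal_nonneg
  have hw1 : w ≤ 1 := measureReal_le_one
  by_cases hw1' : w = 1
  · refine ⟨∅, empty_subset _, .empty, ?_, by simp⟩
    rw [sdiff_empty, measureReal_le_eq_one_sub hY, ← hw, hw1', sub_self]
    exact hε.le
  -- A level just above `w = P(Y < y)` has quantile at least `y`, and `P(y ≤ Y < q_Y(v)) ≤ v - w <
  -- ε`.
  obtain ⟨v, hwv, hv⟩ := exists_between
    (lt_min (lt_of_le_of_ne hw1 hw1') (lt_add_of_pos_right w hε))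
  have hv1 : v ∈ Ioo (0 : ℝ) 1 := ⟨hw0.trans_lt hwv, hv.trans_le (min_le_left _ _)⟩
  have hyq : y ≤ quantile μ Y v := by
    refine le_of_forall_lt fun z hz => ?_
    rw [← distFun_lt_iff hv1]
    exact ((isLUB_distFun_image_Iio hY y).1 ⟨z, hz, rfl⟩).trans_lt hwv
  have hsub : {ω | quantile μ Y v ≤ Y ω} ⊆ {ω | y ≤ Y ω} := fun ω hω => hyq.trans hω
  refine ⟨_, hsub, hmeas _, ?_, h v hv1⟩
  rw [measureReal_sdiff hsub (hmeas _), measureReal_le_eq_one_sub hY, measureReal_le_eq_one_sub hY]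
  have := measureReal_lt_quantile_le (μ := μ) hY hv1
  have := hv.trans_le (min_le_right _ _)
  linarith

/-- A lower set of reals is empty, everything, or an open or closed half-line. The closure supplies
the values `0`, `1` and the left limits `P(Y < a)`. -/
theorem measureReal_preimage_mem_closure (hY : Measurable Y) {L : Set ℝ} (hL : IsLowerSet L) :
    μ.real (Y ⁻¹' L) ∈ closure (range (distFun μ Y)) := by
  rcases L.eq_empty_or_nonempty with rfl | hne
  · simpa using mem_closure_of_tendsto (f := distFun μ Y) (tendsto_cdf_atBot (μ.map Y))
      (.of_forall mem_range_self)
  by_cases hb : BddAbove L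
  · by_cases ha : sSup L ∈ L
    · have : L = Iic (sSup L) :=
        Subset.antisymm (fun x hx => le_csSup hb hx) fun x hx => hL hx ha
      rw [this]
      exact subset_closure ⟨sSup L, distFun_eq hY _⟩
    · have : L = Iio (sSup L) := by
        refine Subset.antisymm (fun x hx => lt_of_le_of_ne (le_csSup hb hx) ?_) fun x hx => ?_
        · rintro rfl
          exact ha hx
        · obtain ⟨z, hz, hxz⟩ := exists_lt_of_lt_csSup hne hx
          exact hL hxz.le hz
      rw [this]
      refine closure_mono (image_subset_range _ _)
        ((isLUB_distFun_image_Iio hY (sSup L)).mem_closure ?_)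
      exact (nonempty_Iio).image _
  · have : L = univ := by
      refine eq_univ_of_forall fun x => ?_
      obtain ⟨z, hz, hxz⟩ := not_bddAbove_iff.1 hb x
      exact hL hxz.le hz
    rw [this]
    simpa using mem_closure_of_tendsto (f := distFun μ Y) (tendsto_cdf_atTop (μ.map Y))
      (.of_forall mem_range_self)

/-- Monotone transformations that preserve the probabilities of lower half-lines preserve the
closure of the range of the distribution function. -/
theorem closure_range_distFun_comp (hY : Measurable Y) {g : ℝ → ℝ} (hg : Monotone g)
    (h : ∀ y, μ.real {ω | g (Y ω) ≤ g y} = μ.real {ω | Y ω ≤ y}) :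
    closure (range (distFun μ fun ω => g (Y ω))) = closure (range (distFun μ Y)) := by
  have hgY : Measurable fun ω => g (Y ω) := hg.measurable.comp hY
  refine Subset.antisymm (closure_minimal ?_ isClosed_closure) (closure_mono ?_)
  · rintro _ ⟨u, rfl⟩
    rw [distFun_eq hgY]
    exact measureReal_preimage_mem_closure hY (L := {y | g y ≤ u})
      fun a b hba (ha : g a ≤ u) => (hg hba).trans ha
  · rintro _ ⟨y, rfl⟩
    exact ⟨g y, by rw [distFun_eq hgY, distFun_eq hY, h]⟩

/-- Upper sets of reals are totally ordered by inclusion, so the two events are nested; equal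
probability makes their difference null. -/
theorem setOf_quantile_le_comp_ae_eq (hY : Measurable Y) {g : ℝ → ℝ} (hg : Monotone g)
    (h : ∀ y, μ.real {ω | g (Y ω) ≤ g y} = μ.real {ω | Y ω ≤ y}) {v : ℝ}
    (hv : v ∈ Ioo (0 : ℝ) 1) :
    {ω | quantile μ (fun ω => g (Y ω)) v ≤ g (Y ω)} =ᵐ[μ] {ω | quantile μ Y v ≤ Y ω} := by
  have hgY : Measurable fun ω => g (Y ω) := hg.measurable.comp hY
  have hm := measureReal_quantile_le_eq hgY hY (closure_range_distFun_comp hY hg h) hv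
  have hm' : μ {ω | quantile μ (fun ω => g (Y ω)) v ≤ g (Y ω)} = μ {ω | quantile μ Y v ≤ Y ω} :=
    (measureReal_eq_measureReal_iff).1 hm
  have h1 : MeasurableSet {ω | quantile μ Y v ≤ Y ω} := measurableSet_le measurable_const hY
  have h2 : MeasurableSet {ω | quantile μ (fun ω => g (Y ω)) v ≤ g (Y ω)} :=
    measurableSet_le measurable_const hgY
  have hup : IsUpperSet {y | quantile μ (fun ω => g (Y ω)) v ≤ g y} :=
    fun a b hab ha => le_trans ha (hg hab)
  rcases hup.total (isUpperSet_Ici (quantile μ Y v)) with hs | hs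
  · exact ae_eq_of_subset_of_measure_ge (preimage_mono (f := Y) hs) hm'.ge h2.nullMeasurableSet
      (measure_ne_top _ _)
  · exact (ae_eq_of_subset_of_measure_ge (preimage_mono (f := Y) hs) hm'.le h1.nullMeasurableSet
      (measure_ne_top _ _)).symm

/-- `Y` puts no mass on the flat stretch of `F_Y` to the right of `y`: each `(y, z]` inside it is
null, and either its largest point or its rational points give a countable cover. -/
theorem measure_distFun_le_and_lt (hY : Measurable Y) (y : ℝ) :
    μ {ω | distFun μ Y (Y ω) ≤ distFun μ Y y ∧ y < Y ω} = 0 := by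
  set J := {z | distFun μ Y z ≤ distFun μ Y y ∧ y < z} with hJ
  have hnull : ∀ z ∈ J, μ (Y ⁻¹' Ioc y z) = 0 := by
    intro z hz
    have hsub : {ω | Y ω ≤ y} ⊆ {ω | Y ω ≤ z} := fun ω hω => le_trans hω hz.2.le
    have heq : Y ⁻¹' Ioc y z = {ω | Y ω ≤ z} \ {ω | Y ω ≤ y} := by
      ext ω
      simp [and_comm]
    rw [heq, ← measureReal_eq_zero_iff, measureReal_sdiff hsub
      (measurableSet_le hY measurable_const), ← distFun_eq hY, ← distFun_eq hY]
    exact sub_eq_zero.2 (le_antisymm hz.1 (monotone_distFun μ Y hz.2.le))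
  change μ (Y ⁻¹' J) = 0
  by_cases hmax : ∃ z, IsGreatest J z
  · obtain ⟨z, hz⟩ := hmax
    have hsub : J ⊆ Ioc y z := fun x hx => ⟨hx.2, hz.2 hx⟩
    exact measure_mono_null (preimage_mono hsub) (hnull z hz.1)
  · have hcov : Y ⁻¹' J ⊆ ⋃ r : {r : ℚ // (r : ℝ) ∈ J}, Y ⁻¹' Ioc y (r : ℚ) := by
      intro ω hω
      obtain ⟨z, hz, hlt⟩ : ∃ z ∈ J, Y ω < z := by
        by_contra! hcon
        exact hmax ⟨Y ω, hω, hcon⟩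
      obtain ⟨r, hr1, hr2⟩ := exists_rat_btwn hlt
      have hr : (r : ℝ) ∈ J := ⟨(monotone_distFun μ Y hr2.le).trans hz.1, hω.2.trans hr1⟩
      exact mem_iUnion.2 ⟨⟨r, hr⟩, hω.2, hr1.le⟩
    exact measure_mono_null hcov (measure_iUnion_null fun r => hnull _ r.2)

theorem measureReal_distFun_le (hY : Measurable Y) (y : ℝ) :
    μ.real {ω | distFun μ Y (Y ω) ≤ distFun μ Y y} = μ.real {ω | Y ω ≤ y} := by
  refine measureReal_congr ?_
  have h := measure_eq_zero_iff_ae_notMem.1 (measure_distFun_le_and_lt (μ := μ) hY y)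
  refine Filter.eventuallyEq_set.2 ?_
  filter_upwards [h] with ω hω
  refine ⟨fun h1 => ?_, fun h1 => monotone_distFun μ Y h1⟩
  by_contra h2
  exact hω ⟨h1, not_le.1 h2⟩

end Quantile

/-! ### Conditioning on random vectors and conditional independence -/

section Conditioning

variable {Ω β γ : Type*} {m n m₀ : MeasurableSpace Ω} {μ : Measure Ω}
  [MeasurableSpace β] [MeasurableSpace γ]

/-- If `Y` can be compared with all rational thresholds by observing `X`, then `Y` is almost surely
a measurable function of `X`. -/
theorem exists_measurable_ae_eq_comp {X : Ω → β} {Y : Ω → ℝ}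
    (h : ∀ r : ℚ, ∃ B : Set β, MeasurableSet B ∧
      ∀ᵐ ω ∂μ, ((r : ℝ) < Y ω → X ω ∈ B) ∧ (X ω ∈ B → (r : ℝ) ≤ Y ω)) :
    ∃ f : β → ℝ, Measurable f ∧ Y =ᵐ[μ] fun ω => f (X ω) := by
  classical
  choose B hB hBY using h
  -- `Y` is recovered as the supremum of the rationals below it. The supremum may be infinite off a
  -- full-measure event, where `toReal` gives the harmless value `0`.
  refine ⟨fun x => (⨆ r : ℚ, if x ∈ B r then ((r : ℝ) : EReal) else ⊥).toReal, ?_, ?_⟩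
  · exact (Measurable.iSup fun r =>
      Measurable.ite (hB r) measurable_const measurable_const).ereal_toReal
  · filter_upwards [ae_all_iff.2 hBY] with ω hω
    have : (⨆ r : ℚ, if X ω ∈ B r then ((r : ℝ) : EReal) else ⊥) = (Y ω : EReal) := by
      refine le_antisymm (iSup_le fun r => ?_) (le_of_forall_lt fun c hc => ?_)
      · split_ifs with hr
        · exact EReal.coe_le_coe_iff.2 ((hω r).2 hr)
        · exact bot_le
      · obtain ⟨r, hcr, hrY⟩ := EReal.lt_iff_exists_rat_btwn.1 hc
        refine hcr.trans_le (le_iSup_of_le r ?_)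
        rw [if_pos ((hω r).1 (EReal.coe_lt_coe_iff.1 hrY))]
    rw [this, EReal.toReal_coe]

/-- A set integral identity on rectangles extends to all events determined by a pair. -/
theorem setIntegral_eq_of_rectangles {X : Ω → β} {Z : Ω → γ} (hX : Measurable X)
    (hZ : Measurable Z) {f g : Ω → ℝ} (hf : Integrable f μ) (hg : Integrable g μ)
    (h : ∀ B C, MeasurableSet B → MeasurableSet C →
      ∫ ω in X ⁻¹' B ∩ Z ⁻¹' C, f ω ∂μ = ∫ ω in X ⁻¹' B ∩ Z ⁻¹' C, g ω ∂μ)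
    {u : Set (β × γ)} (hu : MeasurableSet u) :
    ∫ ω in (fun ω => (X ω, Z ω)) ⁻¹' u, f ω ∂μ =
      ∫ ω in (fun ω => (X ω, Z ω)) ⁻¹' u, g ω ∂μ := by
  have hW : Measurable fun ω => (X ω, Z ω) := hX.prodMk hZ
  induction u, hu using MeasurableSpace.induction_on_inter generateFrom_prod.symm
    isPiSystem_prod with
  | empty => simp
  | basic t ht =>
    obtain ⟨B, hB, C, hC, rfl⟩ := ht
    exact h B C hB hC
  | compl t ht ih =>
    have htot : ∫ ω, f ω ∂μ = ∫ ω, g ω ∂μ := by simpa using h univ univ .univ .univ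
    rw [preimage_compl, setIntegral_compl (hW ht) hf, setIntegral_compl (hW ht) hg, htot, ih]
  | iUnion f' hd hf' ih =>
    have hd' : Pairwise (Function.onFun Disjoint fun i => (fun ω => (X ω, Z ω)) ⁻¹' f' i) :=
      fun i j hij => (hd hij).preimage _
    rw [preimage_iUnion, integral_iUnion (fun i => hW (hf' i)) hd' hf.integrableOn,
      integral_iUnion (fun i => hW (hf' i)) hd' hg.integrableOn]
    exact tsum_congr ih

variable [IsProbabilityMeasure μ]

/-- Random variables that are almost surely functions of each other give the same conditional
expectations. -/
theorem condExp_comap_ae_eq {X : Ω → β} {X' : Ω → γ} (hX : Measurable X) (hX' : Measurable X')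
    {h : β → γ} {k : γ → β} (hh : Measurable h) (hk : Measurable k)
    (hX'X : X' =ᵐ[μ] fun ω => h (X ω)) (hXX' : X =ᵐ[μ] fun ω => k (X' ω))
    {f : Ω → ℝ} (hf : Integrable f μ) :
    μ[f | MeasurableSpace.comap X inferInstance] =ᵐ[μ]
      μ[f | MeasurableSpace.comap X' inferInstance] := by
  refine ae_eq_condExp_of_forall_setIntegral_eq hX'.comap_le hf
    (fun s _ _ => integrable_condExp.integrableOn) ?_ ?_
  · rintro _ ⟨C, hC, rfl⟩ -
    have hs : X' ⁻¹' C =ᵐ[μ] X ⁻¹' (h ⁻¹' C) := by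
      refine Filter.eventuallyEq_set.2 ?_
      filter_upwards [hX'X] with ω hω
      simp [hω]
    rw [setIntegral_congr_set hs, setIntegral_congr_set hs]
    exact setIntegral_condExp hX.comap_le hf ⟨_, hh hC, rfl⟩
  · obtain ⟨g, hg, hgX⟩ := StronglyMeasurable.exists_eq_measurable_comp
      (stronglyMeasurable_condExp (μ := μ) (f := f) (m := MeasurableSpace.comap X inferInstance))
    refine ⟨fun ω => g (k (X' ω)),
      hg.comp_measurable (hk.comp (comap_measurable X')), ?_⟩
    filter_upwards [hXX'] with ω hω
    rw [hgX, Function.comp_apply, hω]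

theorem mul_indicator_const_one (f : Ω → ℝ) (t : Set Ω) :
    f * t.indicator (fun _ => (1 : ℝ)) = t.indicator f := by
  ext ω
  by_cases h : ω ∈ t <;> simp [h]

/-- Tower property: given `n` the event `t` is known, so `P(s ∩ t | n) = P(s | m) 1_t`; then project
onto `m`. -/
theorem condProb_inter_ae_eq_mul (hmn : m ≤ n) (hn : n ≤ m₀) {s t : Set Ω}
    (hs : MeasurableSet s) (ht : MeasurableSet[n] t) (h : μ⟦s | n⟧ =ᵐ[μ] μ⟦s | m⟧) :
    μ⟦s ∩ t | m⟧ =ᵐ[μ] μ⟦s | m⟧ * μ⟦t | m⟧ := by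
  have hsi : Integrable (s.indicator fun _ => (1 : ℝ)) μ := integrable_indicator_const_one hs
  have hti : Integrable (t.indicator fun _ => (1 : ℝ)) μ :=
    integrable_indicator_const_one (hn _ ht)
  have h1 : μ⟦s ∩ t | n⟧ =ᵐ[μ] μ⟦s | m⟧ * t.indicator fun _ => (1 : ℝ) := by
    have e : (s ∩ t).indicator (fun _ => (1 : ℝ)) =
        s.indicator (fun _ => (1 : ℝ)) * t.indicator fun _ => (1 : ℝ) := by
      rw [mul_indicator_const_one, indicator_indicator, inter_comm]
    rw [e]
    refine (condExp_mul_of_stronglyMeasurable_right (stronglyMeasurable_const.indicator ht) ?_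
      hsi).trans ?_
    · rw [mul_indicator_const_one]
      exact hsi.indicator (hn _ ht)
    · filter_upwards [h] with ω hω
      simp [hω]
  refine (condExp_condExp_of_le hmn hn).symm.trans ((condExp_congr_ae h1).trans ?_)
  refine condExp_mul_of_stronglyMeasurable_left stronglyMeasurable_condExp ?_ hti
  rw [mul_indicator_const_one]
  exact integrable_condExp.indicator (hn _ ht)

/-- Both sides equal the integral of `P(s ∩ t | m)` over `B`, because `P(s | m) 1_t` has conditional
expectation `P(s | m) P(t | m)`. This is the defining identity of conditional expectation on
rectangles. -/
theorem setIntegral_condProb_of_inter_ae_eq_mul (hm : m ≤ m₀) {s t B : Set Ω}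
    (hs : MeasurableSet s) (ht : MeasurableSet t) (hB : MeasurableSet[m] B)
    (h : μ⟦s ∩ t | m⟧ =ᵐ[μ] μ⟦s | m⟧ * μ⟦t | m⟧) :
    ∫ ω in B ∩ t, (μ⟦s | m⟧) ω ∂μ = ∫ ω in B ∩ t, s.indicator (fun _ => (1 : ℝ)) ω ∂μ := by
  have hti : Integrable (t.indicator fun _ => (1 : ℝ)) μ := integrable_indicator_const_one ht
  have hi : Integrable (μ⟦s | m⟧ * t.indicator fun _ => (1 : ℝ)) μ := by
    rw [mul_indicator_const_one]
    exact integrable_condExp.indicator ht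
  have key : μ⟦s ∩ t | m⟧ =ᵐ[μ] μ[μ⟦s | m⟧ * t.indicator fun _ => (1 : ℝ) | m] :=
    h.trans (condExp_mul_of_stronglyMeasurable_left stronglyMeasurable_condExp hi hti).symm
  calc ∫ ω in B ∩ t, (μ⟦s | m⟧) ω ∂μ
      = ∫ ω in B, (μ⟦s | m⟧ * t.indicator fun _ => (1 : ℝ)) ω ∂μ := by
        rw [mul_indicator_const_one, setIntegral_indicator ht]
    _ = ∫ ω in B, (μ⟦s ∩ t | m⟧) ω ∂μ := by
        rw [← setIntegral_condExp hm hi hB]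
        exact setIntegral_congr_ae (hm _ hB) (key.mono fun ω hω _ => hω.symm)
    _ = ∫ ω in B, (s ∩ t).indicator (fun _ => (1 : ℝ)) ω ∂μ :=
        setIntegral_condExp hm (integrable_indicator_const_one (hs.inter ht)) hB
    _ = ∫ ω in B ∩ t, s.indicator (fun _ => (1 : ℝ)) ω ∂μ := by
        rw [inter_comm s t, ← indicator_indicator, setIntegral_indicator ht]

end Conditioning

/-! ### The σ-algebra of a joint vector -/

section Join

variable {Ω : Type*} {m₀ : MeasurableSpace Ω} {μ : Measure Ω} {p q : ℕ} {X : Ω → Fin p → ℝ}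
  {Z : Ω → Fin q → ℝ}

theorem measurable_append : Measurable fun x : (Fin p → ℝ) × (Fin q → ℝ) =>
    (Fin.append x.1 x.2 : Fin (p + q) → ℝ) := by
  refine measurable_pi_iff.2 fun i => ?_
  refine Fin.addCases (fun i => ?_) (fun i => ?_) i
  · simp only [Fin.append_left]
    fun_prop
  · simp only [Fin.append_right]
    fun_prop

theorem measurable_join (hX : Measurable X) (hZ : Measurable Z) : Measurable (join X Z) :=
  measurable_append.comp (hX.prodMk hZ)

theorem comap_join : MeasurableSpace.comap (join X Z) inferInstance =
    MeasurableSpace.comap (fun ω => (X ω, Z ω)) inferInstance := by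
  have hW : (fun ω => (X ω, Z ω)) =
      (fun x : Fin (p + q) → ℝ => (fun i => x (Fin.castAdd q i), fun i => x (Fin.natAdd p i))) ∘
        join X Z := by
    ext ω <;> simp [join]
  refine le_antisymm ?_ ?_
  · have : join X Z = (fun x : (Fin p → ℝ) × (Fin q → ℝ) => Fin.append x.1 x.2) ∘
        fun ω => (X ω, Z ω) := rfl
    rw [this, ← MeasurableSpace.comap_comp]
    exact MeasurableSpace.comap_mono measurable_append.comap_le
  · rw [hW, ← MeasurableSpace.comap_comp]
    exact MeasurableSpace.comap_mono (Measurable.comap_le (by fun_prop))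

theorem comap_le_comap_join : MeasurableSpace.comap X inferInstance ≤
    MeasurableSpace.comap (join X Z) inferInstance := by
  rw [comap_join]
  rintro _ ⟨B, hB, rfl⟩
  exact ⟨Prod.fst ⁻¹' B, measurable_fst hB, rfl⟩

theorem comap_right_le_comap_join : MeasurableSpace.comap Z inferInstance ≤
    MeasurableSpace.comap (join X Z) inferInstance := by
  rw [comap_join]
  rintro _ ⟨B, hB, rfl⟩
  exact ⟨Prod.snd ⁻¹' B, measurable_snd hB, rfl⟩

/-- `Y` and `Z` are conditionally independent given `X` if and only if `Z` does not change the
conditional law of `Y` given `X`. -/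
theorem condIndepGiven_iff [IsProbabilityMeasure μ] {Y : Ω → ℝ} (hY : Measurable Y)
    (hX : Measurable X) (hZ : Measurable Z) :
    CondIndepGiven μ Y Z X ↔ ∀ s, MeasurableSet s →
      μ⟦Y ⁻¹' s | MeasurableSpace.comap (join X Z) inferInstance⟧ =ᵐ[μ]
        μ⟦Y ⁻¹' s | MeasurableSpace.comap X inferInstance⟧ := by
  refine ⟨fun h s hs => ?_, fun h s t hs ht => ?_⟩
  · have hi : Integrable ((Y ⁻¹' s).indicator fun _ => (1 : ℝ)) μ :=
      integrable_indicator_const_one (hY hs)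
    refine (ae_eq_condExp_of_forall_setIntegral_eq (measurable_join hX hZ).comap_le hi
      (fun _ _ _ => integrable_condExp.integrableOn) (fun u hu _ => ?_) ?_).symm
    · rw [comap_join] at hu
      obtain ⟨u, hu, rfl⟩ := hu
      refine setIntegral_eq_of_rectangles hX hZ integrable_condExp hi (fun B C hB hC => ?_) hu
      exact setIntegral_condProb_of_inter_ae_eq_mul hX.comap_le (hY hs) (hZ hC) ⟨B, hB, rfl⟩
        (h s C hs hC)
    · exact (stronglyMeasurable_condExp.mono comap_le_comap_join).aestronglyMeasurable
  · exact condProb_inter_ae_eq_mul comap_le_comap_join (measurable_join hX hZ).comap_le (hY hs)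
      (comap_right_le_comap_join _ ⟨t, ht, rfl⟩) (h s hs)

end Join

/-! ### Properties of the conditional convex order -/

section Order

variable {Ω : Type*} {m₀ : MeasurableSpace Ω} {μ : Measure Ω} {Y Y' : Ω → ℝ} {p p' q : ℕ}
  {X : Ω → Fin p → ℝ} {X' : Ω → Fin p' → ℝ} {Z : Ω → Fin q → ℝ} {A : Set ℝ}

theorem ConvexOrder.trans {S T U : Ω → ℝ} (h₁ : ConvexOrder μ S T) (h₂ : ConvexOrder μ T U) :
    ConvexOrder μ S U := fun φ hφ => (h₁ φ hφ).trans (h₂ φ hφ)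

theorem Equiv.of_ae_eq (h : ∀ v ∈ Ioo (0 : ℝ) 1,
    condSurv μ Y X (quantile μ Y v) =ᵐ[μ] condSurv μ Y' X' (quantile μ Y' v)) :
    Equiv μ Y X Y' X' :=
  ⟨fun v hv => .of_ae_eq (h v hv), fun v hv => .of_ae_eq (h v hv).symm⟩

theorem measurable_distFun (μ : Measure Ω) (Y : Ω → ℝ) : Measurable (distFun μ Y) :=
  (monotone_distFun μ Y).measurable

theorem measurable_marginalTransform (hX : Measurable X) : Measurable (marginalTransform μ X) :=
  measurable_pi_iff.2 fun i => (measurable_distFun μ _).comp (measurable_pi_iff.1 hX i)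

variable [IsProbabilityMeasure μ]

/-- The conditional probability is a kernel evaluated at `X`, and that kernel depends only on the
joint law. -/
theorem integral_condSurv_congr {φ : ℝ → ℝ} (hφ : Continuous φ)
    (hY : Measurable Y) (hY' : Measurable Y') {X' : Ω → Fin p → ℝ}
    (hX : Measurable X) (hX' : Measurable X')
    (h : IdentDistrib (fun ω => (Y ω, X ω)) (fun ω => (Y' ω, X' ω)) μ μ) (y : ℝ) :
    ∫ ω, φ (condSurv μ Y X y ω) ∂μ = ∫ ω, φ (condSurv μ Y' X' y ω) ∂μ := by
  have hκ : condDistrib Y X μ = condDistrib Y' X' μ := by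
    rw [condDistrib_def, condDistrib_def]
    have hmap : μ.map (fun ω => (X ω, Y ω)) = μ.map (fun ω => (X' ω, Y' ω)) :=
      (h.comp measurable_swap).map_eq
    simp only [hmap]
  have h1 := condDistrib_ae_eq_condExp (μ := μ) hX hY (measurableSet_Ici (a := y))
  have h2 := condDistrib_ae_eq_condExp (μ := μ) hX' hY' (measurableSet_Ici (a := y))
  have hψ : Measurable fun x => φ ((condDistrib Y X μ x).real (Ici y)) :=
    hφ.measurable.comp (Kernel.measurable_coe _ measurableSet_Ici).ennreal_toReal
  calc ∫ ω, φ (condSurv μ Y X y ω) ∂μ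
      = ∫ ω, φ ((condDistrib Y X μ (X ω)).real (Ici y)) ∂μ :=
        integral_congr_ae (h1.mono fun ω hω => congrArg φ hω.symm)
    _ = ∫ ω, φ ((condDistrib Y X μ (X' ω)).real (Ici y)) ∂μ :=
        ((h.comp measurable_snd).comp hψ).integral_eq
    _ = _ := by
        rw [hκ]
        exact integral_congr_ae (h2.mono fun ω hω => congrArg φ hω)

theorem Equiv.of_identDistrib (hY : Measurable Y) (hY' : Measurable Y') {X' : Ω → Fin p → ℝ}
    (hX : Measurable X) (hX' : Measurable X')
    (h : IdentDistrib (fun ω => (Y ω, X ω)) (fun ω => (Y' ω, X' ω)) μ μ) :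
    Equiv μ Y X Y' X' := by
  have hF : μ.map Y = μ.map Y' := (h.comp measurable_fst).map_eq
  have hq (v : ℝ) : quantile μ Y v = quantile μ Y' v := by
    simp only [quantile, distFun, hF]
  refine ⟨fun v _ φ hφ => ?_, fun v _ φ hφ => ?_⟩
  · rw [hq]
    exact (integral_condSurv_congr hφ.continuous_real hY hY' hX hX' h _).le
  · rw [hq]
    exact (integral_condSurv_congr hφ.continuous_real hY hY' hX hX' h _).ge

theorem Le.join (hY : Measurable Y) (hX : Measurable X) (hZ : Measurable Z) :
    Le μ Y X Y (join X Z) := fun _ _ =>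
  convexOrder_condProb comap_le_comap_join (measurable_join hX hZ).comap_le
    (measurableSet_le measurable_const hY)

/-- If the finer information `X'` does not increase the conditional convex order, then `X` and `X'`
give the same conditional law of `Y`. -/
theorem Le.condProb_ae_eq (h : Le μ Y X' Y X) (hY : Measurable Y) (hX' : Measurable X')
    (hXX' : MeasurableSpace.comap X inferInstance ≤ MeasurableSpace.comap X' inferInstance)
    {s : Set ℝ} (hs : MeasurableSet s) :
    μ⟦Y ⁻¹' s | MeasurableSpace.comap X' inferInstance⟧ =ᵐ[μ]
      μ⟦Y ⁻¹' s | MeasurableSpace.comap X inferInstance⟧ :=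
  condProb_preimage_ae_eq_of_quantile (hXX'.trans hX'.comap_le) hX'.comap_le hY
    (fun v hv => condProb_ae_eq_of_convexOrder hXX' hX'.comap_le
      (measurableSet_le measurable_const hY) (h v hv)) hs

theorem equiv_join_iff (hY : Measurable Y) (hX : Measurable X) (hZ : Measurable Z) :
    Equiv μ Y X Y (CCX.join X Z) ↔ CondIndepGiven μ Y Z X := by
  rw [condIndepGiven_iff hY hX hZ]
  exact ⟨fun h s hs => h.2.condProb_ae_eq hY (measurable_join hX hZ) comap_le_comap_join hs,
    fun h => Equiv.of_ae_eq fun v _ => (h _ measurableSet_Ici).symm⟩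

theorem condProb_bot (s : Set Ω) (hs : MeasurableSet s) :
    μ⟦s | (⊥ : MeasurableSpace Ω)⟧ = fun _ => μ.real s := by
  rw [condExp_bot, integral_indicator_const _ hs]
  simp

/-- A constant vector generates the trivial σ-algebra, so rigidity makes the conditional law of `Y`
given `X` equal to its unconditional law. -/
theorem Le.indepFun (hY : Measurable Y) (hX : Measurable X)
    (h : Le μ Y X Y (fun (_ : Ω) (_ : Fin 1) => (0 : ℝ))) : IndepFun X Y μ := by
  rw [indepFun_iff_measure_inter_preimage_eq_mul]
  intro B s hB hs
  have hle : MeasurableSpace.comap (fun (_ : Ω) (_ : Fin 1) => (0 : ℝ)) inferInstance ≤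
      MeasurableSpace.comap X inferInstance := by
    rw [MeasurableSpace.comap_const]
    exact bot_le
  have key := h.condProb_ae_eq hY hX hle hs
  rw [MeasurableSpace.comap_const, condProb_bot _ (hY hs)] at key
  have h1 : ∫ ω in X ⁻¹' B, (Y ⁻¹' s).indicator (fun _ => (1 : ℝ)) ω ∂μ =
      ∫ ω in X ⁻¹' B, μ.real (Y ⁻¹' s) ∂μ := by
    rw [← setIntegral_condExp hX.comap_le (integrable_indicator_const_one (hY hs)) ⟨B, hB, rfl⟩]
    exact setIntegral_congr_ae (hX hB) (key.mono fun ω hω _ => hω)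
  rw [setIntegral_indicator (hY hs), setIntegral_const, setIntegral_const, smul_eq_mul,
    smul_eq_mul, mul_one] at h1
  rw [← ENNReal.toReal_eq_toReal_iff' (measure_ne_top _ _)
    (ENNReal.mul_ne_top (measure_ne_top _ _) (measure_ne_top _ _)), ENNReal.toReal_mul]
  exact h1

theorem MemClass.measureReal_quantile_eq (h : MemClass μ A Y X) (h' : MemClass μ A Y' X') {v : ℝ}
    (hv : v ∈ Ioo (0 : ℝ) 1) :
    μ.real {ω | quantile μ Y v ≤ Y ω} = μ.real {ω | quantile μ Y' v ≤ Y' ω} :=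
  measureReal_quantile_le_eq h.measurable_fst h'.measurable_fst
    (h.closure_range.trans h'.closure_range.symm) hv

theorem Le.of_indepFun (h : MemClass μ A Y X) (h' : MemClass μ A Y' X') (hind : IndepFun X Y μ) :
    Le μ Y X Y' X' := by
  intro v hv
  have hY := h.measurable_fst
  have hs : MeasurableSet {ω | quantile μ Y v ≤ Y ω} := measurableSet_le measurable_const hY
  have hs' : MeasurableSet {ω | quantile μ Y' v ≤ Y' ω} :=
    measurableSet_le measurable_const h'.measurable_fst
  have hconst : condSurv μ Y X (quantile μ Y v) =ᵐ[μ]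
      μ⟦{ω | quantile μ Y' v ≤ Y' ω} | (⊥ : MeasurableSpace Ω)⟧ := by
    rw [condProb_bot _ hs', ← h.measureReal_quantile_eq h' hv]
    refine (condExp_indep_eq hY.comap_le h.measurable_snd.comap_le
      (stronglyMeasurable_const.indicator ⟨_, measurableSet_Ici, rfl⟩) hind.symm).trans ?_
    refine .of_forall fun _ => ?_
    change ∫ ω, {ω | quantile μ Y v ≤ Y ω}.indicator (fun _ => (1 : ℝ)) ω ∂μ = _
    rw [integral_indicator_const _ hs]
    simp
  exact (ConvexOrder.of_ae_eq hconst).trans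
    (convexOrder_condProb bot_le h'.measurable_snd.comap_le hs')

theorem Le.of_perfectlyDependent (h : MemClass μ A Y X) (h' : MemClass μ A Y' X')
    (hp : PerfectlyDependent μ Y X) : Le μ Y' X' Y X := by
  obtain ⟨f, hf, hYf⟩ := hp
  intro v hv
  have hs' : MeasurableSet {ω | quantile μ Y' v ≤ Y' ω} :=
    measurableSet_le measurable_const h'.measurable_fst
  have hX := h.measurable_snd
  have ht : MeasurableSet[MeasurableSpace.comap X inferInstance]
      (X ⁻¹' (f ⁻¹' Ici (quantile μ Y v))) := ⟨_, hf measurableSet_Ici, rfl⟩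
  have hst : {ω | quantile μ Y v ≤ Y ω} =ᵐ[μ] X ⁻¹' (f ⁻¹' Ici (quantile μ Y v)) := by
    refine Filter.eventuallyEq_set.2 ?_
    filter_upwards [hYf] with ω hω
    simp [hω]
  refine convexOrder_indicator integrable_condExp.aestronglyMeasurable
    (condProb_mem_Icc h'.measurable_snd.comap_le hs') (hX.comap_le _ ht) ?_ ?_
  · refine (condProb_congr_set hst).trans (.of_eq ?_)
    exact condExp_of_stronglyMeasurable hX.comap_le (stronglyMeasurable_const.indicator ht)
      (integrable_indicator_const_one (hX.comap_le _ ht))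
  · refine (integral_condProb h'.measurable_snd.comap_le hs').trans ?_
    rw [← h.measureReal_quantile_eq h' hv]
    exact measureReal_congr hst

/-- Given `(X, Y)` the event `{Y > r}` is known, so by rigidity its indicator is almost surely a
function `g(X)`; the set `{g = 1}` then decides the threshold `r` from `X`. -/
theorem Le.perfectlyDependent (hY : Measurable Y) (hX : Measurable X)
    (h : Le μ Y (CCX.join X fun ω (_ : Fin 1) => Y ω) Y X) : PerfectlyDependent μ Y X := by
  have hZ : Measurable fun ω (_ : Fin 1) => Y ω := measurable_pi_lambda _ fun _ => hY
  refine exists_measurable_ae_eq_comp fun r => ?_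
  have hs : MeasurableSet (Y ⁻¹' Ioi (r : ℝ)) := hY measurableSet_Ioi
  have hsJ : MeasurableSet[MeasurableSpace.comap (CCX.join X fun ω (_ : Fin 1) => Y ω)
      inferInstance] (Y ⁻¹' Ioi (r : ℝ)) :=
    comap_right_le_comap_join _
      ⟨(fun z => z 0) ⁻¹' Ioi (r : ℝ), measurable_pi_apply 0 measurableSet_Ioi, rfl⟩
  have key := h.condProb_ae_eq hY (measurable_join hX hZ) comap_le_comap_join
    (measurableSet_Ioi (a := (r : ℝ)))
  rw [condExp_of_stronglyMeasurable (measurable_join hX hZ).comap_le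
    (stronglyMeasurable_const.indicator hsJ) (integrable_indicator_const_one hs)] at key
  obtain ⟨g, hg, hgX⟩ := StronglyMeasurable.exists_eq_measurable_comp
    (stronglyMeasurable_condExp (μ := μ) (f := (Y ⁻¹' Ioi (r : ℝ)).indicator fun _ => (1 : ℝ))
      (m := MeasurableSpace.comap X inferInstance))
  rw [hgX] at key
  refine ⟨g ⁻¹' {1}, hg.measurable (measurableSet_singleton 1), ?_⟩
  filter_upwards [key] with ω hω
  by_cases hr : (r : ℝ) < Y ω
  · have : g (X ω) = 1 := by simpa [hr] using hω.symm
    exact ⟨fun _ => this, fun _ => hr.le⟩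
  · have : g (X ω) = 0 := by simpa [hr] using hω.symm
    exact ⟨fun h => absurd h hr, fun h => by simp [this] at h⟩

/-- Monotone transformations of `Y` that preserve the probabilities of lower half-lines, together
with almost surely invertible transformations of `X`, do not affect the conditional convex
order. -/
theorem Equiv.of_transform (hY : Measurable Y) (hX : Measurable X) (hX' : Measurable X')
    {g : ℝ → ℝ} (hg : Monotone g)
    (hgY : ∀ y, μ.real {ω | g (Y ω) ≤ g y} = μ.real {ω | Y ω ≤ y})
    {h : (Fin p → ℝ) → Fin p' → ℝ} {k : (Fin p' → ℝ) → Fin p → ℝ} (hh : Measurable h)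
    (hk : Measurable k) (hX'X : X' =ᵐ[μ] fun ω => h (X ω)) (hXX' : X =ᵐ[μ] fun ω => k (X' ω)) :
    Equiv μ Y X (fun ω => g (Y ω)) X' :=
  Equiv.of_ae_eq fun _ hv =>
    (condExp_comap_ae_eq hX hX' hh hk hX'X hXX'
      (integrable_indicator_const_one (measurableSet_le measurable_const hY))).trans
    (condProb_congr_set (setOf_quantile_le_comp_ae_eq hY hg hgY hv).symm)

theorem MemClass.comp (h : MemClass μ A Y X) {g : ℝ → ℝ} (hg : Monotone g)
    (hgY : ∀ y, μ.real {ω | g (Y ω) ≤ g y} = μ.real {ω | Y ω ≤ y}) (hp' : 1 ≤ p')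
    (hX' : Measurable X') : MemClass μ A (fun ω => g (Y ω)) X' where
  one_le_dim := hp'
  measurable_fst := hg.measurable.comp h.measurable_fst
  measurable_snd := hX'
  closure_range := (closure_range_distFun_comp h.measurable_fst hg hgY).trans h.closure_range

/-- A random variable is almost surely a measurable function of its probability integral
transform. -/
theorem exists_ae_eq_comp_distFun (hY : Measurable Y) :
    ∃ k : ℝ → ℝ, Measurable k ∧ Y =ᵐ[μ] fun ω => k (distFun μ Y (Y ω)) := by
  refine exists_measurable_ae_eq_comp (X := fun ω => distFun μ Y (Y ω)) fun r =>
    -- `F_Y(Y) > F_Y(r)` forces `Y > r` by monotonicity; the converse fails only on the null flat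
    -- stretch right of `r`.
    ⟨Ioi (distFun μ Y r), measurableSet_Ioi, ?_⟩
  filter_upwards [measure_eq_zero_iff_ae_notMem.1 (measure_distFun_le_and_lt (μ := μ) hY r)]
    with ω hω
  refine ⟨fun h => ?_, fun h => ((monotone_distFun μ Y).reflect_lt h).le⟩
  by_contra hc
  exact hω ⟨not_lt.1 hc, h⟩

theorem equiv_marginalTransform (hY : Measurable Y) (hX : Measurable X) :
    Equiv μ Y X Y (marginalTransform μ X) := by
  choose k hk hkX using fun i => exists_ae_eq_comp_distFun (μ := μ) (measurable_pi_iff.1 hX i)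
  refine Equiv.of_transform (g := id) hY hX (measurable_marginalTransform hX) monotone_id
    (fun _ => rfl) (h := fun x i => distFun μ (fun ω => X ω i) (x i))
    (k := fun u i => k i (u i)) ?_ ?_ (.of_forall fun _ => rfl) ?_
  · exact measurable_pi_iff.2 fun i => (measurable_distFun μ _).comp (measurable_pi_apply i)
  · exact measurable_pi_iff.2 fun i => (hk i).comp (measurable_pi_apply i)
  · filter_upwards [ae_all_iff.2 hkX] with ω hω
    exact funext hω

theorem one_le_of_bijective {h : (Fin p → ℝ) → Fin q → ℝ} (hh : Function.Bijective h)
    (hp : 1 ≤ p) : 1 ≤ q := by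
  by_contra! hq
  obtain rfl : q = 0 := by lia
  have := congrFun (hh.1 (Subsingleton.elim (h 0) (h 1))) ⟨0, hp⟩
  simp at this

end Order

end CCX

/-! ### The full list of properties -/

theorem theorem1 {Ω : Type*} [MeasurableSpace Ω] (μ : Measure Ω) [IsProbabilityMeasure μ]
    (A : Set ℝ) (hA : IsClosed A) (hA01 : A ⊆ Icc (0 : ℝ) 1) :
    -- law-invariance
    (∀ (p : ℕ) (Y Y' : Ω → ℝ) (X X' : Ω → Fin p → ℝ),
      CCX.MemClass μ A Y X → CCX.MemClass μ A Y' X' →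
      IdentDistrib (fun ω => (Y ω, X ω)) (fun ω => (Y' ω, X' ω)) μ μ →
      CCX.Equiv μ Y X Y' X') ∧
    -- reflexivity and transitivity
    (∀ (p : ℕ) (Y : Ω → ℝ) (X : Ω → Fin p → ℝ), CCX.MemClass μ A Y X → CCX.Le μ Y X Y X) ∧
    (∀ (p₁ p₂ p₃ : ℕ) (Y₁ Y₂ Y₃ : Ω → ℝ)
      (X₁ : Ω → Fin p₁ → ℝ) (X₂ : Ω → Fin p₂ → ℝ) (X₃ : Ω → Fin p₃ → ℝ),
      CCX.MemClass μ A Y₁ X₁ → CCX.MemClass μ A Y₂ X₂ → CCX.MemClass μ A Y₃ X₃ →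
      CCX.Le μ Y₁ X₁ Y₂ X₂ → CCX.Le μ Y₂ X₂ Y₃ X₃ → CCX.Le μ Y₁ X₁ Y₃ X₃) ∧
    -- characterization of independence
    (∀ (p : ℕ) (Y : Ω → ℝ) (X : Ω → Fin p → ℝ), CCX.MemClass μ A Y X →
      ((∀ (p' : ℕ) (Y' : Ω → ℝ) (X' : Ω → Fin p' → ℝ), CCX.MemClass μ A Y' X' →
          CCX.Le μ Y X Y' X') ↔
        IndepFun X Y μ)) ∧
    -- characterization of perfect dependence
    (∀ (p : ℕ) (Y : Ω → ℝ) (X : Ω → Fin p → ℝ), CCX.MemClass μ A Y X →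
      ((∀ (p' : ℕ) (Y' : Ω → ℝ) (X' : Ω → Fin p' → ℝ), CCX.MemClass μ A Y' X' →
          CCX.Le μ Y' X' Y X) ↔
        CCX.PerfectlyDependent μ Y X)) ∧
    -- information monotonicity
    (∀ (p q : ℕ) (Y : Ω → ℝ) (X : Ω → Fin p → ℝ) (Z : Ω → Fin q → ℝ),
      CCX.MemClass μ A Y X → Measurable Z →
      CCX.Le μ Y X Y (CCX.join X Z)) ∧
    -- characterization of conditional independence
    (∀ (p q : ℕ) (Y : Ω → ℝ) (X : Ω → Fin p → ℝ) (Z : Ω → Fin q → ℝ),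
      CCX.MemClass μ A Y X → Measurable Z →
      (CCX.Equiv μ Y X Y (CCX.join X Z) ↔ CCX.CondIndepGiven μ Y Z X)) ∧
    -- transformation invariance
    (∀ (p q : ℕ) (Y : Ω → ℝ) (X : Ω → Fin p → ℝ) (g : ℝ → ℝ) (h : (Fin p → ℝ) → (Fin q → ℝ)),
      CCX.MemClass μ A Y X → StrictMono g → Measurable h → Function.Bijective h →
      CCX.MemClass μ A (fun ω => g (Y ω)) (fun ω => h (X ω)) ∧
      CCX.Equiv μ Y X (fun ω => g (Y ω)) (fun ω => h (X ω))) ∧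
    -- distributional invariance
    (∀ (p : ℕ) (Y : Ω → ℝ) (X : Ω → Fin p → ℝ), CCX.MemClass μ A Y X →
      (CCX.MemClass μ A (fun ω => CCX.distFun μ Y (Y ω)) X ∧
        CCX.Equiv μ Y X (fun ω => CCX.distFun μ Y (Y ω)) X) ∧
      (CCX.MemClass μ A Y (CCX.marginalTransform μ X) ∧
        CCX.Equiv μ Y X Y (CCX.marginalTransform μ X))) := by
  refine ⟨fun p Y Y' X X' h h' hid => ?_, fun p Y X _ v _ φ _ => le_rfl,
    fun p₁ p₂ p₃ Y₁ Y₂ Y₃ X₁ X₂ X₃ _ _ _ h₁₂ h₂₃ v hv => (h₁₂ v hv).trans (h₂₃ v hv),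
    fun p Y X h => ⟨fun hle => ?_, fun hind p' Y' X' h' => .of_indepFun h h' hind⟩,
    fun p Y X h => ⟨fun hle => ?_, fun hp p' Y' X' h' => .of_perfectlyDependent h h' hp⟩,
    fun p q Y X Z h hZ => .join h.measurable_fst h.measurable_snd hZ,
    fun p q Y X Z h hZ => CCX.equiv_join_iff h.measurable_fst h.measurable_snd hZ,
    fun p q Y X g k h hg hk hbij => ?_, fun p Y X h => ⟨?_, ?_⟩⟩
  · exact .of_identDistrib h.measurable_fst h'.measurable_fst h.measurable_snd h'.measurable_snd hid
  -- The test competitor keeps `Y`, hence stays in the class, and carries no information.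
  · exact (hle 1 Y (fun _ _ => 0)
      ⟨le_rfl, h.measurable_fst, measurable_const, h.closure_range⟩).indepFun
        h.measurable_fst h.measurable_snd
  -- Here the competitor keeps `Y` and observes `Y` itself in addition to `X`.
  · refine (hle (p + 1) Y (CCX.join X fun ω _ => Y ω)
      ⟨Nat.le_add_left 1 p, h.measurable_fst, CCX.measurable_join h.measurable_snd
        (measurable_pi_lambda _ fun _ => h.measurable_fst), h.closure_range⟩).perfectlyDependent
        h.measurable_fst h.measurable_snd
  · have hgY (y : ℝ) : μ.real {ω | g (Y ω) ≤ g y} = μ.real {ω | Y ω ≤ y} := by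
      simp only [hg.le_iff_le]
    have hX' : Measurable fun ω => k (X ω) := hk.comp h.measurable_snd
    -- By Lusin–Souslin an injective Borel map between Euclidean spaces is a measurable embedding;
    -- extending the identity along it gives a measurable left inverse.
    obtain ⟨k', hk', hkk'⟩ := (hk.measurableEmbedding hbij.1).exists_measurable_extend
      measurable_id fun _ => inferInstance
    refine ⟨h.comp hg.monotone hgY (CCX.one_le_of_bijective hbij h.one_le_dim) hX',
      .of_transform h.measurable_fst h.measurable_snd hX' hg.monotone hgY hk hk'
        (.of_forall fun _ => rfl) (.of_forall fun ω => (congrFun hkk' (X ω)).symm)⟩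
  · have hF := CCX.measureReal_distFun_le (μ := μ) h.measurable_fst
    have hmono := CCX.monotone_distFun μ Y
    exact ⟨h.comp hmono hF h.one_le_dim h.measurable_snd,
      .of_transform h.measurable_fst h.measurable_snd h.measurable_snd hmono hF measurable_id
        measurable_id (.of_forall fun _ => rfl) (.of_forall fun _ => rfl)⟩
  · exact ⟨⟨h.one_le_dim, h.measurable_fst, CCX.measurable_marginalTransform h.measurable_snd,
      h.closure_range⟩, CCX.equiv_marginalTransform h.measurable_fst h.measurable_snd⟩
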